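/- For $k\in\mathbb N$ let $\mathbb F_k$ be the free group on a fixed basis of $k$ elements. A $k$-marked group (a group with a generating $k$-tuple, up to isomorphism) is identified with the normal subgroup $N\trianglelefteq\mathbb F_k$ of its relations, the group being $\mathbb F_k/N$. The set $\mathcal G_k$ of $k$-marked groups carries the topology induced by the product topology of $\{0,1\}^{\mathbb F_k}$, and the space of marked groups is the topological disjoint union $\mathcal G=\bigsqcup_k\mathcal G_k$. For each $k$ fix an enumeration (a surjection) $\theta_k:\mathbb N\to\mathbb F_k$. The word problem representation of $\mathcal G$ is the partial surjection $\mathbb N^{\mathbb N}\rightharpoonup\mathcal G$ for which $u$ is a name of $N\trianglelefteq\mathbb F_k$ if and only if $u_0=k$ and, for all $i$, $u_{i+1}=1$ if $\theta_k(i)\in N$ and $u_{i+1}=0$ otherwise. For a class $\mathcal C$ of groups, $\mathrm{Res}_{\mathcal C}:\mathcal G\to\mathcal G$ sends a marked group $G$ to its greatest residually-$\mathcal C$ quotient $G/\bigcap\{\ker f\mid f:G\twoheadrightarrow H,\ H\in\mathcal C\}$ with the induced marking (the trivial group if $G$ has no quotient in $\mathcal C$). It is regarded as a problem, with the word problem representation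 on both sides. A problem is a partial multi-function between represented spaces. It is continuously realizable if some continuous partial function on $\mathbb N^{\mathbb N}$ sends each name of each point $x$ of its domain to a name of one of its values at $x$. Write $Q\le_W P$, for problems $P:\subseteq Z\rightrightarrows W$ and $Q:\subseteq X\rightrightarrows Y$, if there are a represented space $V$ and continuously realizable partial multi-functions $h:\subseteq V\times W\rightrightarrows Y$ and $k:\subseteq X\rightrightarrows V\times Z$ such that every $x\in\mathrm{dom}(Q)$ lies in the domain of $h\circ(\mathrm{id}_V\times P)\circ k$ and every value of this composition at $x$ is a value of $Q$ at $x$; here $x\in\mathrm{dom}(g\circ f)$ means that $x\in\mathrm{dom}(f)$ and $f(x)\subseteq\mathrm{dom}(g)$. Problems $P,Q$ are Weihrauch equivalent if $P\le_W Q$ and $Q\le_W P$. For a set $\mathcal S$ of finitely generated simple groups, let $\mathcal C_{\mathcal S}$ be the class of all groups into which no group of $\mathcal S$ embeds. Proposition. There are exactly $2^{2^{\aleph_0}}$ maps of the form $\mathrm{Res}_{\mathcal C}$, with $\mathcal C$ a class of groups. Moreover, there are $2^{2^{\aleph_0}}$ pairwise Weihrauch-inequivalent problems of the form $\mathrm{Res}_{\mathcal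 C_{\mathcal S}}$, with $\mathcal S$ a set of finitely generated simple groups. In particular, for some such $\mathcal S$, the map $\mathrm{Res}_{\mathcal C_{\mathcal S}}:\mathcal G\to\mathcal G$ is not Borel measurable. -/

import Mathlib

open scoped Cardinal

namespace ResWeihrauch

/-! ### Represented spaces and continuous Weihrauch reducibility -/

/-- Baire space, with its product topology (`ℕ` is discrete). -/
abbrev Baire : Type := ℕ → ℕ

/-- A represented space: a set `carrier` with a partial surjection from Baire space onto it,
given by its graph: `IsName p x` says that `p` is in the domain and is sent to `x`. -/
structure RepSpace where
  carrier : Type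
  IsName : Baire → carrier → Prop
  functional : ∀ p x y, IsName p x → IsName p y → x = y
  surjective : ∀ x, ∃ p, IsName p x

/-- The product of two represented spaces: the even part of a name is a name of the first
coordinate, the odd part a name of the second one. -/
def RepSpace.prod (X Y : RepSpace) : RepSpace where
  carrier := X.carrier × Y.carrier
  IsName p z := X.IsName (fun n => p (2 * n)) z.1 ∧ Y.IsName (fun n => p (2 * n + 1)) z.2
  functional := by
    intro p x y hx hy
    exact Prod.ext (X.functional _ _ _ hx.1 hy.1) (Y.functional _ _ _ hx.2 hy.2)
  surjective := by
    rintro ⟨x, y⟩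
    obtain ⟨p, hp⟩ := X.surjective x
    obtain ⟨q, hq⟩ := Y.surjective y
    refine ⟨fun n => if n % 2 = 0 then p (n / 2) else q (n / 2), ?_, ?_⟩
    · have h : (fun n => if (2 * n) % 2 = 0 then p (2 * n / 2) else q (2 * n / 2)) = p := by
        funext n
        rw [if_pos (by omega), show 2 * n / 2 = n by omega]
      simpa only [h] using hp
    · have h : (fun n => if (2 * n + 1) % 2 = 0 then p ((2 * n + 1) / 2)
          else q ((2 * n + 1) / 2)) = q := by
        funext n
        rw [if_neg (by omega), show (2 * n + 1) / 2 = n by omega]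
      simpa only [h] using hq

/-- A partial multi-function from `X` to `Y`, sending a point to its set of values. -/
abbrev MultiFun (X Y : Type) : Type := X → Set Y

namespace MultiFun

variable {X Y Z W : Type}

/-- The domain of a multi-function. -/
def dom (f : MultiFun X Y) : Set X := {x | (f x).Nonempty}

/-- Composition of multi-functions: `x` is in the domain of `g ∘ f` when `x` is in the domain of
`f` and every value of `f` at `x` is in the domain of `g`. -/
def comp (g : MultiFun Y Z) (f : MultiFun X Y) : MultiFun X Z :=
  fun x => {z | f x ⊆ g.dom ∧ ∃ y ∈ f x, z ∈ g y}

/-- The multi-function `id_V × f`. -/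
def idProd (V : Type) (f : MultiFun X Y) : MultiFun (V × X) (V × Y) :=
  fun a => {b | b.1 = a.1 ∧ b.2 ∈ f a.2}

/-- `f` solves `g`. -/
def Solves (f g : MultiFun X Y) : Prop :=
  g.dom ⊆ f.dom ∧ ∀ x ∈ g.dom, f x ⊆ g x

end MultiFun

/-- `F`, as a partial function on Baire space with domain `D`, realizes the multi-function `f`:
each name of a point `x` of the domain of `f` is in `D` and is sent to a name of some value of `f`
at `x`. -/
def IsRealizer {X Y : RepSpace} (f : MultiFun X.carrier Y.carrier)
    (D : Set Baire) (F : Baire → Baire) : Prop :=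
  ∀ p x, X.IsName p x → x ∈ f.dom → p ∈ D ∧ ∃ y ∈ f x, Y.IsName (F p) y

/-- `f` has a continuous (partial) realizer. -/
def ContinuouslyRealizable {X Y : RepSpace} (f : MultiFun X.carrier Y.carrier) : Prop :=
  ∃ (D : Set Baire) (F : Baire → Baire), ContinuousOn F D ∧ IsRealizer (X := X) (Y := Y) f D F

/-- A problem: a multi-function between represented spaces. -/
structure Problem where
  X : RepSpace
  Y : RepSpace
  f : MultiFun X.carrier Y.carrier

/-- `WeihrauchLE Q P`: the problem `Q` continuously Weihrauch reduces to the problem `P`. -/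
def WeihrauchLE (Q P : Problem) : Prop :=
  ∃ (V : RepSpace) (h : MultiFun (V.prod P.Y).carrier Q.Y.carrier)
    (k : MultiFun Q.X.carrier (V.prod P.X).carrier),
    ContinuouslyRealizable (X := V.prod P.Y) (Y := Q.Y) h ∧
    ContinuouslyRealizable (X := Q.X) (Y := V.prod P.X) k ∧
    MultiFun.Solves (MultiFun.comp h (MultiFun.comp (MultiFun.idProd V.carrier P.f) k)) Q.f

/-- Continuous Weihrauch equivalence. -/
def WeihrauchEquiv (P Q : Problem) : Prop := WeihrauchLE P Q ∧ WeihrauchLE Q P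

/-! ### The space of marked groups -/

/-- Isomorphism classes of `k`-marked groups, identified with the normal subgroups of the free
group of rank `k`: a group with generating tuple `(s₁, …, sₖ)` corresponds to its set of
relations, and the normal subgroup `N` to the quotient by `N`, marked by the images of the basis. -/
def KMarkedGroup (k : ℕ) : Type := {N : Subgroup (FreeGroup (Fin k)) // N.Normal}

/-- The characteristic function of the set of relations of a marked group. -/
noncomputable def KMarkedGroup.char {k : ℕ} (N : KMarkedGroup k) : FreeGroup (Fin k) → Bool :=
  fun w => by
    classical exact decide (w ∈ N.1)

/-- The topology induced by the product topology of `{0, 1} ^ Fₖ` (with `{0, 1}` discrete). -/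
noncomputable instance (k : ℕ) : TopologicalSpace (KMarkedGroup k) :=
  TopologicalSpace.induced KMarkedGroup.char inferInstance

/-- The space of marked groups, with the disjoint union topology. -/
abbrev MarkedGroup : Type := Σ k : ℕ, KMarkedGroup k

/-- The word problem representation of the space of marked groups, for given enumerations `θ k` of
the free groups of rank `k`: a name of a `k`-marked group consists of `k` followed by the
characteristic sequence of the set of relations. -/
noncomputable def wordProblemSpace (θ : ∀ k : ℕ, ℕ → FreeGroup (Fin k))
    (hθ : ∀ k, Function.Surjective (θ k)) : RepSpace where
  carrier := MarkedGroup
  IsName u G := u 0 = G.1 ∧ ∀ i, u (i + 1) = if G.2.char (θ G.1 i) = true then 1 else 0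
  functional := by
    rintro u ⟨k, M⟩ ⟨l, N⟩ ⟨hk, hM⟩ ⟨hl, hN⟩
    obtain rfl : k = l := hk.symm.trans hl
    refine congrArg (Sigma.mk k) (Subtype.ext (Subgroup.ext fun w => ?_))
    obtain ⟨i, rfl⟩ := hθ k w
    have h := (hM i).symm.trans (hN i)
    by_cases h1 : θ k i ∈ M.1 <;> by_cases h2 : θ k i ∈ N.1 <;>
      simp [KMarkedGroup.char, h1, h2] at h ⊢
  surjective := by
    rintro G
    exact ⟨fun n => Nat.casesOn n G.1
      fun i => if G.2.char (θ G.1 i) = true then 1 else 0, rfl, fun i => rfl⟩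

/-! ### Greatest residually-`C` quotients -/

/-- The intersection of the kernels of all surjective homomorphisms from `G` to groups of `C`. -/
def residualKernel (C : Set GrpCat.{0}) (G : Type) [Group G] : Subgroup G :=
  ⨅ (H : GrpCat.{0}) (_ : H ∈ C) (f : G →* H) (_ : Function.Surjective f), f.ker

theorem residualKernel_normal (C : Set GrpCat.{0}) (G : Type) [Group G] :
    (residualKernel C G).Normal := by
  refine ⟨fun n hn g => ?_⟩
  simp only [residualKernel, Subgroup.mem_iInf] at hn ⊢
  exact fun H hH f hf => (MonoidHom.normal_ker f).conj_mem n (hn H hH f hf) g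

/-- The greatest residually-`C` quotient of a `k`-marked group `G = Fₖ ⧸ N`, as a `k`-marked group:
its relations are the words whose image in `G` lies in the residual kernel of `G`. -/
def KMarkedGroup.res (C : Set GrpCat.{0}) {k : ℕ} (N : KMarkedGroup k) : KMarkedGroup k :=
  letI := N.2
  ⟨(residualKernel C (FreeGroup (Fin k) ⧸ N.1)).comap (QuotientGroup.mk' N.1),
    (residualKernel_normal C _).comap _⟩

/-- The map `Res_C` on the space of marked groups. -/
def Res (C : Set GrpCat.{0}) (G : MarkedGroup) : MarkedGroup := ⟨G.1, G.2.res C⟩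

/-- The class of the groups into which no group of `S` embeds. -/
def avoidingClass (S : Set GrpCat.{0}) : Set GrpCat.{0} :=
  {G | ∀ H ∈ S, ¬ ∃ f : H →* G, Function.Injective f}

/-- All members of `S` are finitely generated simple groups. -/
def IsSetOfFGSimple (S : Set GrpCat.{0}) : Prop :=
  ∀ H ∈ S, Group.FG H ∧ IsSimpleGroup H

/-- A (total, single-valued) map between marked groups as a problem, for the word problem
representation on both sides. -/
noncomputable def problemOf (θ : ∀ k : ℕ, ℕ → FreeGroup (Fin k))
    (hθ : ∀ k, Function.Surjective (θ k)) (R : MarkedGroup → MarkedGroup) : Problem where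
  X := wordProblemSpace θ hθ
  Y := wordProblemSpace θ hθ
  f := fun G => {R G}

end ResWeihrauch

/-!
The heart of the matter is a family `(F / M a)`, indexed by the points `a` of the Cantor space, of
finitely generated simple groups none of which embeds into another (`exists_antichain`). Given it,
let `S` be the set of the `F / M a` with `a ∈ A`. A member of the family with index in `A` has no
nontrivial quotient avoiding `S`, so its image under `Res` is trivial; a member with index outside
`A` avoids `S` and is fixed. So `Res (avoidingClass S)` determines `A`, and the `2 ^ 𝔠` subsets of
the Cantor space give `2 ^ 𝔠` distinct maps (`exists_res_family`).

*Uncountably many simple groups.* Let `R` be a ring containing elements `x`, `y`, `z` such that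
`y xⁿ z` is `1` for `n ∈ P` and `0` otherwise; such `x`, `y`, `z` exist among the endomorphisms of
the group of integer sequences. In the group generated by the elementary matrices of size three with
coefficients `1`, `x`, `y`, `z`, the matrix `E₀₁(1)` normally generates everything, so there is a
maximal normal subgroup, and `E₀₁(1)` is not in it. By the Steinberg relations `E₀₁(y xⁿ z)` is a
fixed word in the generators. It survives in the simple quotient if and only if `n ∈ P`, so that
distinct `P` give distinct normal subgroups of a free group of finite rank `k`
(`exists_not_countable_isMaximalNormal`).

*The antichain.* The normal subgroups of the free group with simple quotient form a Borel subset of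
`{0, 1} ^ F`; being uncountable, it contains a continuous injective image of the Cantor space. An
embedding `F / M → F / N` lifts to one of the countably many endomorphisms `φ` of `F`, and
`M = φ⁻¹ N`. For fixed `φ` the map `N ↦ φ⁻¹ N` is continuous, so embeddability is a countable union
of closed graphs of functions. These are nowhere dense, and Mycielski's theorem
(`exists_cantor_family`) provides a subfamily, again indexed by the Cantor space, of groups none of
which embeds into another.

*Counting.* A continuous partial function on Baire space is coded by a subset of a countable set,
so at most `𝔠` single-valued problems reduce to a given one (`mk_setOf_weihrauchLE_le`). A maximal
family of pairwise inequivalent problems among the `2 ^ 𝔠` constructed ones hence has `2 ^ 𝔠`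
members. If all these maps were Borel measurable, the preimages of the closed set of trivial marked
groups would be `2 ^ 𝔠` distinct Borel sets, of which there are only `𝔠`.
-/

namespace ResWeihrauch

open Matrix
open scoped commutatorElement

/-! ### Elementary matrices of size three -/

section Elementary

variable {R : Type*} [Ring R]

/-- The elementary matrix `1 + r eᵢⱼ` of size three, as a unit. On the diagonal, where this need
not be invertible, it is the identity by convention. -/
def elementary (i j : Fin 3) (r : R) : (Matrix (Fin 3) (Fin 3) R)ˣ :=
  if h : i = j then 1 else
    { val := 1 + single i j r
      inv := 1 - single i j r
      val_inv := by
        have h2 : single i j r * single i j r = 0 :=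
          single_mul_single_of_ne r i j i (Ne.symm h) r
        rw [add_mul, mul_sub, mul_sub, h2]; simp
      inv_val := by
        have h2 : single i j r * single i j r = 0 :=
          single_mul_single_of_ne r i j i (Ne.symm h) r
        rw [sub_mul, mul_add, mul_add, h2]; simp }

theorem elementary_self (i : Fin 3) (r : R) : elementary i i r = 1 := by simp [elementary]

theorem val_elementary {i j : Fin 3} (h : i ≠ j) (r : R) :
    (elementary i j r : Matrix (Fin 3) (Fin 3) R) = 1 + single i j r := by
  simp [elementary, h]

theorem val_inv_elementary {i j : Fin 3} (h : i ≠ j) (r : R) :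
    ((elementary i j r)⁻¹ : (Matrix (Fin 3) (Fin 3) R)ˣ).val = 1 - single i j r := by
  simp [elementary, h, Units.inv_mk]

theorem elementary_zero (i j : Fin 3) : elementary i j (0 : R) = 1 := by
  by_cases h : i = j
  · rw [h, elementary_self]
  · ext1; simp [val_elementary h]

theorem elementary_one_ne_one [Nontrivial R] {i j : Fin 3} (h : i ≠ j) :
    elementary i j (1 : R) ≠ 1 := by
  intro h1
  have h2 := congrArg (fun u : (Matrix (Fin 3) (Fin 3) R)ˣ => u.val i j) h1
  simp [val_elementary h, h] at h2

/-- The Steinberg relation: products of coefficients are commutators of elementary matrices. -/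
theorem elementary_commutator {i k j : Fin 3} (hik : i ≠ k) (hkj : k ≠ j) (hij : i ≠ j) (a b : R) :
    ⁅elementary i k a, elementary k j b⁆ = elementary i j (a * b) := by
  ext1
  rw [commutatorElement_def]
  simp only [Units.val_mul, val_elementary hik, val_elementary hkj, val_elementary hij,
    val_inv_elementary hik, val_inv_elementary hkj]
  rw [← single_mul_single_same a i k j b]
  have haa : single i k a * single i k a = 0 := single_mul_single_of_ne a i k i hik.symm a
  have hbb : single k j b * single k j b = 0 := single_mul_single_of_ne b k j k hkj.symm b
  have hba : single k j b * single i k a = 0 := single_mul_single_of_ne b k j i hij.symm a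
  generalize single i k a = x at *
  generalize single k j b = y at *
  have h1 : (1 + x) * (1 + y) * (1 - x) * (1 - y)
      = 1 + x * y - x * x + x * x * y - y * y - y * x + y * x * y - x * (y * x)
        + x * (y * x) * y - x * (y * y) := by noncomm_ring
  rw [h1, haa, hbb, hba]
  simp

end Elementary

/-! ### Operators with prescribed products -/

section Operators

/-- The weighted composition operator `v ↦ c · (v ∘ g)` on integer sequences. -/
def weightedComp (c : ℕ → ℤ) (g : ℕ → ℕ) : Module.End ℤ (ℕ → ℤ) where
  toFun v m := c m * v (g m)
  map_add' u v := by funext m; simp [mul_add]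
  map_smul' a v := by funext m; simp [mul_left_comm]

/-- Sequences are read as double sequences through `Nat.pair`; this is the left shift of the first
index. -/
def shiftOp : Module.End ℤ (ℕ → ℤ) :=
  weightedComp 1 fun m => Nat.pair (m.unpair.1 + 1) m.unpair.2

/-- The restriction of a double sequence to first index `0`. -/
def restrictOp : Module.End ℤ (ℕ → ℤ) := weightedComp 1 fun m => Nat.pair 0 m

open Classical in
/-- The double sequence whose `n`-th row is `v` for `n ∈ P` and `0` for `n ∉ P`. -/
noncomputable def spreadOp (P : Set ℕ) : Module.End ℤ (ℕ → ℤ) :=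
  weightedComp (fun m => if m.unpair.1 ∈ P then 1 else 0) fun m => m.unpair.2

open Classical in
theorem shiftOp_pow_mul_spreadOp (P : Set ℕ) (n : ℕ) (v : ℕ → ℤ) (m : ℕ) :
    (shiftOp ^ n * spreadOp P) v m
      = (if m.unpair.1 + n ∈ P then 1 else 0) * v m.unpair.2 := by
  induction n generalizing m with
  | zero => simp [spreadOp, weightedComp]
  | succ n ih =>
    have h : (shiftOp ^ (n + 1) * spreadOp P) v m
        = (shiftOp ^ n * spreadOp P) v (Nat.pair (m.unpair.1 + 1) m.unpair.2) := by
      rw [pow_succ', mul_assoc, Module.End.mul_apply]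
      simp [shiftOp, weightedComp]
    rw [h, ih]
    simp [add_assoc, add_comm 1 n]

open Classical in
/-- Selecting the `n`-th row of the spread sequence returns the sequence or zero. -/
theorem restrictOp_mul_shiftOp_pow_mul_spreadOp (P : Set ℕ) (n : ℕ) :
    restrictOp * (shiftOp ^ n * spreadOp P) = if n ∈ P then 1 else 0 := by
  refine LinearMap.ext fun v => funext fun m => ?_
  have h : (restrictOp * (shiftOp ^ n * spreadOp P)) v m
      = (shiftOp ^ n * spreadOp P) v (Nat.pair 0 m) := by
    rw [Module.End.mul_apply]
    simp [restrictOp, weightedComp]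
  rw [h, shiftOp_pow_mul_spreadOp]
  split_ifs <;> simp_all

end Operators

/-! ### Groups generated by elementary matrices -/

section Words

/-- Names of the generators: a position `(i, j)` and one of four coefficients. -/
abbrev Gen : Type := Fin 3 × Fin 3 × Fin 4

/-- The coefficients: the identity and the three operators. -/
noncomputable def coeff (P : Set ℕ) : Fin 4 → Module.End ℤ (ℕ → ℤ) :=
  ![1, shiftOp, restrictOp, spreadOp P]

/-- The representation of the free group sending generators to elementary matrices. -/
noncomputable def elementaryRep (P : Set ℕ) :
    FreeGroup Gen →* (Matrix (Fin 3) (Fin 3) (Module.End ℤ (ℕ → ℤ)))ˣ :=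
  FreeGroup.lift fun g => elementary g.1 g.2.1 (coeff P g.2.2)

theorem elementaryRep_of (P : Set ℕ) (i j : Fin 3) (c : Fin 4) :
    elementaryRep P (FreeGroup.of (i, j, c)) = elementary i j (coeff P c) := by
  simp [elementaryRep]

/-- For `i ≠ j` this is the remaining element of `{0, 1, 2}`, since `0 + 1 + 2 = 0` modulo `3`. -/
def third (i j : Fin 3) : Fin 3 := -(i + j)

theorem ne_third {i j : Fin 3} (h : i ≠ j) : i ≠ third i j := by
  revert i j; decide

theorem third_ne {i j : Fin 3} (h : i ≠ j) : third i j ≠ j := by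
  revert i j; decide

/-- A word representing the elementary matrix with coefficient `shiftOp ^ n * spreadOp P`. -/
def powWord : ℕ → Fin 3 → Fin 3 → FreeGroup Gen
  | 0, i, j => FreeGroup.of (i, j, 3)
  | n + 1, i, j => ⁅(FreeGroup.of (i, third i j, 1) : FreeGroup Gen), powWord n (third i j) j⁆

/-- A word representing the elementary matrix at `(0, 1)` with coefficient `1` if `n ∈ P`, and `0`
otherwise. -/
def testWord (n : ℕ) : FreeGroup Gen :=
  ⁅(FreeGroup.of (0, 2, 2) : FreeGroup Gen), powWord n 2 1⁆

theorem elementaryRep_powWord (P : Set ℕ) (n : ℕ) {i j : Fin 3} (h : i ≠ j) :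
    elementaryRep P (powWord n i j) = elementary i j (shiftOp ^ n * spreadOp P) := by
  induction n generalizing i j with
  | zero => simp [powWord, elementaryRep_of, coeff]
  | succ n ih =>
    rw [powWord, map_commutatorElement, ih (third_ne h), elementaryRep_of,
      elementary_commutator (ne_third h) (third_ne h) h, pow_succ', mul_assoc]
    simp [coeff]

open Classical in
theorem elementaryRep_testWord (P : Set ℕ) (n : ℕ) :
    elementaryRep P (testWord n) = elementary 0 1 (if n ∈ P then 1 else 0) := by
  rw [testWord, map_commutatorElement, elementaryRep_powWord P n (by decide), elementaryRep_of,
    elementary_commutator (by decide) (by decide) (by decide),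
    ← restrictOp_mul_shiftOp_pow_mul_spreadOp]
  simp [coeff]

variable {P : Set ℕ} {N : Subgroup (FreeGroup Gen)}

theorem mem_of_rep_eq (hN : (elementaryRep P).ker ≤ N) {u v : FreeGroup Gen}
    (h : elementaryRep P u = elementaryRep P v) (hv : v ∈ N) : u ∈ N := by
  have h1 : u * v⁻¹ ∈ N := hN (by simp [MonoidHom.mem_ker, h])
  simpa using N.mul_mem h1 hv

theorem commutator_mem_left {G : Type*} [Group G] {N : Subgroup G} [hN : N.Normal] {u : G} (v : G)
    (hu : u ∈ N) : ⁅u, v⁆ ∈ N := by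
  rw [commutatorElement_def, mul_assoc, mul_assoc, ← mul_assoc v]
  exact N.mul_mem hu (hN.conj_mem _ (N.inv_mem hu) v)

theorem commutator_mem_right {G : Type*} [Group G] {N : Subgroup G} [hN : N.Normal] (u : G) {v : G}
    (hv : v ∈ N) : ⁅u, v⁆ ∈ N := by
  rw [commutatorElement_def]
  exact N.mul_mem (hN.conj_mem _ hv u) (N.inv_mem hv)

/-- A single elementary matrix with coefficient `1` normally generates all of them. -/
theorem eq_top_of_mem [N.Normal] (hN : (elementaryRep P).ker ≤ N)
    (h0 : (FreeGroup.of (0, 1, 0) : FreeGroup Gen) ∈ N) : N = ⊤ := by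
  have left : ∀ {i k j : Fin 3} (c : Fin 4), i ≠ k → k ≠ j → i ≠ j →
      (FreeGroup.of (i, k, 0) : FreeGroup Gen) ∈ N →
      (FreeGroup.of (i, j, c) : FreeGroup Gen) ∈ N := by
    intro i k j c hik hkj hij h
    refine mem_of_rep_eq hN ?_ (commutator_mem_left (FreeGroup.of (k, j, c)) h)
    rw [map_commutatorElement, elementaryRep_of, elementaryRep_of, elementaryRep_of,
      elementary_commutator hik hkj hij]
    simp [coeff]
  have right : ∀ {i k j : Fin 3}, i ≠ k → k ≠ j → i ≠ j →
      (FreeGroup.of (k, j, 0) : FreeGroup Gen) ∈ N →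
      (FreeGroup.of (i, j, 0) : FreeGroup Gen) ∈ N := by
    intro i k j hik hkj hij h
    refine mem_of_rep_eq hN ?_ (commutator_mem_right (FreeGroup.of (i, k, 0)) h)
    rw [map_commutatorElement, elementaryRep_of, elementaryRep_of, elementaryRep_of,
      elementary_commutator hik hkj hij]
    simp [coeff]
  -- from the position `(0, 1)`, row and column moves reach every off-diagonal position
  have h02 := left (j := 2) 0 (by decide) (by decide) (by decide) h0
  have h21 := right (i := 2) (by decide) (by decide) (by decide) h0
  have h20 := left (j := 0) 0 (by decide) (by decide) (by decide) h21
  have h12 := right (i := 1) (by decide) (by decide) (by decide) h02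
  have h10 := left (j := 0) 0 (by decide) (by decide) (by decide) h12
  have hall : ∀ i j : Fin 3, i ≠ j → (FreeGroup.of (i, j, 0) : FreeGroup Gen) ∈ N := by
    intro i j hij
    fin_cases i <;> fin_cases j <;> first | exact absurd rfl hij | assumption
  rw [eq_top_iff, ← FreeGroup.closure_range_of, Subgroup.closure_le]
  rintro _ ⟨⟨i, j, c⟩, rfl⟩
  by_cases hij : i = j
  · subst hij
    exact hN (by rw [MonoidHom.mem_ker, elementaryRep_of, elementary_self])
  · exact left c (ne_third hij) (third_ne hij) hij (hall _ _ (ne_third hij))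

end Words

/-! ### Maximal normal subgroups -/

section MaximalNormal

/-- `N` is maximal among the proper normal subgroups; equivalently, the quotient is simple. -/
structure IsMaximalNormal {G : Type*} [Group G] (N : Subgroup G) : Prop where
  normal : N.Normal
  ne_top : N ≠ ⊤
  eq_or_eq_top : ∀ K : Subgroup G, K.Normal → N ≤ K → K = N ∨ K = ⊤

variable {G : Type*} [Group G]

theorem IsMaximalNormal.isSimpleGroup {N : Subgroup G} [N.Normal] (h : IsMaximalNormal N) :
    IsSimpleGroup (G ⧸ N) := by
  have : Nontrivial (G ⧸ N) := by
    rw [QuotientGroup.nontrivial_iff]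
    exact h.ne_top
  refine ⟨fun H hH => ?_⟩
  have hs := QuotientGroup.mk'_surjective N
  rcases h.eq_or_eq_top (H.comap (QuotientGroup.mk' N)) (hH.comap _)
    (by simpa using (MonoidHom.ker_le_comap (QuotientGroup.mk' N) H)) with h1 | h1
  · left
    rw [← Subgroup.map_comap_eq_self_of_surjective hs H, h1]
    exact QuotientGroup.map_mk'_self N
  · right
    rw [← Subgroup.map_comap_eq_self_of_surjective hs H, h1]
    exact Subgroup.map_top_of_surjective _ hs

theorem IsMaximalNormal.comap {G' : Type*} [Group G'] {N : Subgroup G'} (h : IsMaximalNormal N)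
    {f : G →* G'} (hf : Function.Surjective f) : IsMaximalNormal (N.comap f) := by
  refine ⟨h.normal.comap f, fun ht => h.ne_top ?_, fun K hK hle => ?_⟩
  · rw [← Subgroup.map_comap_eq_self_of_surjective hf N, ht, Subgroup.map_top_of_surjective _ hf]
  · have hker : f.ker ≤ K := (MonoidHom.ker_le_comap f N).trans hle
    rw [← Subgroup.comap_map_eq_self hker]
    have hle' : N ≤ K.map f := by
      rw [← Subgroup.map_comap_eq_self_of_surjective hf N]
      exact Subgroup.map_mono hle
    rcases h.eq_or_eq_top _ (hK.map f hf) hle' with h1 | h1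
    · left; rw [h1]
    · right; rw [h1, Subgroup.comap_top]

/-- If a single element `g` normally generates the group modulo `K`, then a proper normal subgroup
containing `K` lies in a maximal one. -/
theorem exists_isMaximalNormal {K : Subgroup G} (hK : K.Normal) {g : G} (hg : g ∉ K)
    (htop : ∀ N : Subgroup G, N.Normal → K ≤ N → g ∈ N → N = ⊤) :
    ∃ M : Subgroup G, IsMaximalNormal M ∧ K ≤ M ∧ g ∉ M := by
  obtain ⟨M, hKM, hM⟩ := zorn_le_nonempty₀ {N : Subgroup G | N.Normal ∧ g ∉ N} (by
    intro c hc hchain y hy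
    have hdir := hchain.directedOn
    refine ⟨sSup c, ⟨Subgroup.sSup_normal c fun s hs => (hc hs).1, fun hgc => ?_⟩,
      fun z hz => le_sSup hz⟩
    rw [Subgroup.mem_sSup_of_directedOn ⟨y, hy⟩ hdir] at hgc
    obtain ⟨s, hs, hgs⟩ := hgc
    exact (hc hs).2 hgs) K ⟨hK, hg⟩
  refine ⟨M, ⟨hM.prop.1, fun h => hM.prop.2 (h ▸ Subgroup.mem_top g), fun L hL hML => ?_⟩, hKM,
    hM.prop.2⟩
  by_cases hgL : g ∈ L
  · exact Or.inr (htop L hL (hKM.trans hML) hgL)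
  · exact Or.inl (le_antisymm (hM.le_of_ge ⟨hL, hgL⟩ hML) hML)

/-- Every set `P` of natural numbers is coded by a maximal normal subgroup: the `n`-th test word
lies in it exactly when `n ∉ P`. -/
theorem exists_isMaximalNormal_testWord (P : Set ℕ) :
    ∃ M : Subgroup (FreeGroup Gen), IsMaximalNormal M ∧ ∀ n, testWord n ∉ M ↔ n ∈ P := by
  obtain ⟨M, hM, hker, hg⟩ := exists_isMaximalNormal
    (K := (elementaryRep P).ker) (g := FreeGroup.of (0, 1, 0)) inferInstance
    (by
      rw [MonoidHom.mem_ker, elementaryRep_of]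
      exact elementary_one_ne_one (by decide))
    (fun N hN hle h => eq_top_of_mem hle h)
  refine ⟨M, hM, fun n => ?_⟩
  by_cases hn : n ∈ P
  · refine iff_of_true (fun h => hg (mem_of_rep_eq hker ?_ h)) hn
    rw [elementaryRep_testWord, if_pos hn, elementaryRep_of]
    rfl
  · refine iff_of_false (not_not.2 (hker ?_)) hn
    rw [MonoidHom.mem_ker, elementaryRep_testWord, if_neg hn, elementary_zero]

/-- Some free group of finite rank has uncountably many normal subgroups with simple quotient. -/
theorem exists_not_countable_isMaximalNormal :
    ∃ k : ℕ, ¬ {M : Subgroup (FreeGroup (Fin k)) | IsMaximalNormal M}.Countable := by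
  refine ⟨Fintype.card Gen, fun hc => ?_⟩
  choose M hM hP using exists_isMaximalNormal_testWord
  let e : FreeGroup (Fin (Fintype.card Gen)) ≃* FreeGroup Gen :=
    FreeGroup.freeGroupCongr (Fintype.equivFin Gen).symm
  have hinj : Function.Injective fun P => (M P).comap e.toMonoidHom := by
    intro P Q h
    have h1 : M P = M Q := Subgroup.comap_injective e.surjective h
    ext n
    rw [← hP P, ← hP Q, h1]
  have hr := hc.mono (Set.range_subset_iff.2 fun P =>
    (hM P).comap (f := e.toMonoidHom) e.surjective)
  have hP : Countable (Set ℕ) := Set.countable_univ_iff.1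
    (Set.countable_of_injective_of_countable_image hinj.injOn (by simpa using hr))
  obtain ⟨f, hf⟩ := exists_injective_nat (Set ℕ)
  exact Function.cantor_injective f hf

end MaximalNormal

/-! ### Independent families in the Cantor space -/

section Mycielski

open Set Topology

/-- Finitely many nonempty open sets can be shrunk so that the product of any two of them with
distinct indices is contained in each of finitely many given dense open sets of pairs. -/
theorem exists_shrink {X ι κ : Type*} [TopologicalSpace X] [CompactSpace X] [T2Space X] [Finite ι]
    [Finite κ] {O : κ → Set (X × X)} (ho : ∀ j, IsOpen (O j)) (hd : ∀ j, Dense (O j))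
    {U : ι → Set X} (hU : ∀ i, IsOpen (U i)) (hne : ∀ i, (U i).Nonempty) :
    ∃ V : ι → Set X, (∀ i, IsOpen (V i) ∧ (V i).Nonempty ∧ closure (V i) ⊆ U i) ∧
      ∀ i i', i ≠ i' → ∀ j, V i ×ˢ V i' ⊆ O j := by
  classical
  let D : ({p : ι × ι // p.1 ≠ p.2} × κ) → Set (ι → X) := fun q =>
    {z | (z q.1.1.1, z q.1.1.2) ∈ O q.2}
  have hDo : ∀ q, IsOpen (D q) := fun q => (ho q.2).preimage (by fun_prop)
  have hDd : ∀ q, Dense (D q) := by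
    rintro ⟨⟨⟨i, i'⟩, hii⟩, j⟩
    rw [dense_iff_inter_open]
    rintro W hW ⟨z, hz⟩
    obtain ⟨u, hu, huW⟩ := isOpen_pi_iff'.1 hW z hz
    obtain ⟨⟨x, y⟩, hxy, hO⟩ := (dense_iff_inter_open.1 (hd j)) (u i ×ˢ u i')
      ((hu i).1.prod (hu i').1) ⟨(z i, z i'), (hu i).2, (hu i').2⟩
    refine ⟨Function.update (Function.update z i x) i' y, huW fun l _ => ?_, ?_⟩
    · rcases eq_or_ne l i' with rfl | h1
      · simpa using hxy.2
      · rcases eq_or_ne l i with rfl | h2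
        · simpa [h1] using hxy.1
        · simpa [h1, h2] using (hu l).2
    · simpa [D, Function.update_of_ne hii] using hO
  have hD := dense_iInter_of_isOpen hDo hDd
  obtain ⟨z, hzU, hzD⟩ := dense_iff_inter_open.1 hD (univ.pi U)
    (isOpen_set_pi finite_univ fun i _ => hU i) (univ_pi_nonempty_iff.2 hne)
  obtain ⟨u, hu, hsub⟩ := isOpen_pi_iff'.1
    ((isOpen_set_pi finite_univ fun i _ => hU i).inter (isOpen_iInter_of_finite hDo)) z ⟨hzU, hzD⟩
  choose t ht htc htu using fun i => exists_mem_nhds_isClosed_subset ((hu i).1.mem_nhds (hu i).2)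
  refine ⟨fun i => interior (t i), fun i => ⟨isOpen_interior,
    ⟨z i, mem_interior_iff_mem_nhds.2 (ht i)⟩, fun x hx => ?_⟩, ?_⟩
  · have hxu : x ∈ u i := htu i (closure_minimal interior_subset (htc i) hx)
    have h := (hsub (a := Function.update z i x) fun l _ => ?_).1 i (mem_univ i)
    · simpa using h
    · rcases eq_or_ne l i with rfl | h2
      · simpa using hxu
      · simpa [h2] using (hu l).2
  · rintro i i' hii j ⟨x, y⟩ ⟨hx, hy⟩
    have h := (hsub (a := Function.update (Function.update z i x) i' y) fun l _ => ?_).2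
    · have h' := mem_iInter.1 h ⟨⟨(i, i'), hii⟩, j⟩
      simpa [D, Function.update_of_ne hii] using h'
    · rcases eq_or_ne l i' with rfl | h1
      · simpa using htu _ (interior_subset hy)
      · rcases eq_or_ne l i with rfl | h2
        · simpa [h1] using htu _ (interior_subset hx)
        · simpa [h1, h2] using (hu l).2

/-- A form of Mycielski's theorem: given countably many dense open sets of pairs, there is a family
indexed by the Cantor space all of whose pairs of members with distinct indices lie in all of
them. -/
theorem exists_cantor_family {X : Type*} [TopologicalSpace X] [CompactSpace X] [T2Space X]
    [Nonempty X] {O : ℕ → Set (X × X)} (ho : ∀ n, IsOpen (O n)) (hd : ∀ n, Dense (O n)) :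
    ∃ g : (ℕ → Bool) → X, ∀ a b, a ≠ b → ∀ n, (g a, g b) ∈ O n := by
  let T : ℕ → Type _ := fun n =>
    {U : (Fin n → Bool) → Set X // ∀ u, IsOpen (U u) ∧ (U u).Nonempty}
  have hstep : ∀ n (U : T n), ∃ V : T (n + 1),
      (∀ u, closure (V.1 u) ⊆ U.1 (fun i => u i.castSucc)) ∧
      ∀ u v, u ≠ v → ∀ j : Fin (n + 1), V.1 u ×ˢ V.1 v ⊆ O j := by
    intro n U
    obtain ⟨V, hV, hVO⟩ := exists_shrink (O := fun j : Fin (n + 1) => O j) (fun j => ho j)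
      (fun j => hd j) (U := fun u : Fin (n + 1) → Bool => U.1 (fun i => u i.castSucc))
      (fun u => (U.2 _).1) (fun u => (U.2 _).2)
    exact ⟨⟨V, fun u => ⟨(hV u).1, (hV u).2.1⟩⟩, fun u => (hV u).2.2, hVO⟩
  choose step hclos hsep using hstep
  let U : ∀ n, T n := fun n =>
    Nat.rec (motive := T) ⟨fun _ => univ, fun _ => ⟨isOpen_univ, univ_nonempty⟩⟩ step n
  let res : (ℕ → Bool) → ∀ n, Fin n → Bool := fun a n i => a i
  have hne : ∀ a : ℕ → Bool, (⋂ n, closure ((U n).1 (res a n))).Nonempty := by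
    intro a
    refine IsCompact.nonempty_iInter_of_sequence_nonempty_isCompact_isClosed _ (fun n => ?_)
      (fun n => ((U n).2 _).2.closure) isClosed_closure.isCompact (fun n => isClosed_closure)
    exact (hclos n (U n) (res a (n + 1))).trans subset_closure
  choose g hg using hne
  refine ⟨g, fun a b hab n => ?_⟩
  have hmem : ∀ a n, g a ∈ (U n).1 (res a n) := fun a n =>
    hclos n (U n) (res a (n + 1)) (mem_iInter.1 (hg a) (n + 1))
  obtain ⟨m, hm⟩ := Function.ne_iff.1 hab
  -- a level at which the indices have separated and the `n`-th condition is active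
  refine hsep (max m n) (U (max m n)) (res a _) (res b _) (fun h => hm ?_)
    ⟨n, by omega⟩ ⟨hmem a (max m n + 1), hmem b (max m n + 1)⟩
  exact congrFun h ⟨m, by omega⟩

theorem exists_ne_of_isOpen_cantor {V : Set (ℕ → Bool)} (hV : IsOpen V) {b : ℕ → Bool}
    (hb : b ∈ V) : ∃ b' ∈ V, b' ≠ b := by
  have ht : Filter.Tendsto (fun n => Function.update b n (!b n)) Filter.atTop (𝓝 b) := by
    rw [tendsto_pi_nhds]
    intro i
    refine tendsto_const_nhds.congr' ?_
    filter_upwards [Filter.eventually_gt_atTop i] with n hn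
    rw [Function.update_of_ne (by omega)]
  obtain ⟨n, hn⟩ := (ht.eventually (hV.mem_nhds hb)).exists
  exact ⟨_, hn, fun h => by simpa using congrFun h n⟩

/-- Along a continuous injection of the Cantor space, one can pass to a subfamily no member of which
is the image of another one under one of countably many given continuous maps. -/
theorem exists_independent_family {Y W : Type*} [TopologicalSpace Y] [T2Space Y] [Countable W]
    [Nonempty W] {c : (ℕ → Bool) → Y} (hc : Continuous c) (hinj : Function.Injective c)
    {Φ : W → Y → Y} (hΦ : ∀ w, Continuous (Φ w)) :
    ∃ g : (ℕ → Bool) → (ℕ → Bool), ∀ a b, a ≠ b → ∀ w, c (g b) ≠ Φ w (c (g a)) := by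
  obtain ⟨e, he⟩ := exists_surjective_nat W
  obtain ⟨g, hg⟩ := exists_cantor_family
    (O := fun n => {p : (ℕ → Bool) × (ℕ → Bool) | c p.2 ≠ Φ (e n) (c p.1)})
    (fun n => isOpen_ne_fun (hc.comp continuous_snd) ((hΦ _).comp (hc.comp continuous_fst)))
    (fun n => by
      rw [dense_iff_inter_open]
      rintro U hU ⟨⟨a, b⟩, hab⟩
      obtain ⟨b', hb', hne⟩ := exists_ne_of_isOpen_cantor
        (V := {x | (a, x) ∈ U}) (hU.preimage (by fun_prop)) hab
      by_cases h : c b = Φ (e n) (c a)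
      · exact ⟨(a, b'), hb', fun h' => hne (hinj (h'.trans h.symm))⟩
      · exact ⟨(a, b), hab, h⟩)
  refine ⟨g, fun a b hab w => ?_⟩
  obtain ⟨n, rfl⟩ := he w
  exact hg a b hab n

end Mycielski

/-! ### Simple groups that do not embed into each other -/

section Antichain

open Set Topology

variable {G : Type*} [Group G]

open Classical in
/-- The characteristic function of a subgroup. -/
noncomputable def charFun (N : Subgroup G) : G → Bool := fun w => decide (w ∈ N)

theorem charFun_eq_true {N : Subgroup G} {w : G} : charFun N w = true ↔ w ∈ N := by
  simp [charFun]

theorem charFun_injective : Function.Injective (charFun (G := G)) := by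
  intro M N h
  ext w
  rw [← charFun_eq_true, ← charFun_eq_true, h]

/-- Characteristic functions of maximal normal subgroups are described by countably many conditions
on their values. The last one says that an element outside the subgroup normally generates the
quotient. -/
theorem mem_image_charFun_iff (χ : G → Bool) :
    χ ∈ charFun '' {M : Subgroup G | IsMaximalNormal M} ↔
      χ 1 = true ∧ (∀ a b, χ a = true → χ b = true → χ (a * b) = true) ∧
      (∀ a, χ a = true → χ a⁻¹ = true) ∧ (∀ a g, χ a = true → χ (g * a * g⁻¹) = true) ∧
      (∃ a, ¬ χ a = true) ∧
      ∀ a, ¬ χ a = true → ∀ b, ∃ c, c ∈ Subgroup.normalClosure {a} ∧ χ (b * c⁻¹) = true := by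
  constructor
  · rintro ⟨M, hM, rfl⟩
    have hn := hM.normal
    simp only [charFun_eq_true]
    refine ⟨M.one_mem, fun a b => M.mul_mem, fun a => M.inv_mem,
      fun a g h => hn.conj_mem a h g, ?_, fun a ha b => ?_⟩
    · by_contra! h
      exact hM.ne_top ((Subgroup.eq_top_iff' M).2 h)
    · have htop : M ⊔ Subgroup.normalClosure {a} = ⊤ := by
        refine (hM.eq_or_eq_top _ (Subgroup.sup_normal _ _) le_sup_left).resolve_left fun h => ha ?_
        rw [← h]
        exact Subgroup.mem_sup_right (Subgroup.subset_normalClosure rfl)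
      obtain ⟨m, hm, c, hc, rfl⟩ := Subgroup.mem_sup_of_normal_right.1
        (htop ▸ Subgroup.mem_top b : b ∈ M ⊔ Subgroup.normalClosure {a})
      exact ⟨c, hc, by simpa using hm⟩
  · rintro ⟨h1, hmul, hinv, hconj, ⟨a, ha⟩, hsimple⟩
    let M : Subgroup G :=
      { carrier := {w | χ w = true}
        mul_mem' := fun {a b} => hmul a b
        one_mem' := h1
        inv_mem' := fun {a} => hinv a }
    have hM : ∀ w, w ∈ M ↔ χ w = true := fun _ => Iff.rfl
    refine ⟨M, ⟨⟨fun a h g => hconj a g h⟩, fun h => ha ((hM a).1 (h ▸ Subgroup.mem_top a)),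
      fun K hK hle => ?_⟩, funext fun w => Bool.eq_iff_iff.2 (by rw [charFun_eq_true, hM])⟩
    by_cases hKM : K ≤ M
    · exact Or.inl (le_antisymm hKM hle)
    · obtain ⟨x, hxK, hxM⟩ := SetLike.not_le_iff_exists.1 hKM
      refine Or.inr ((Subgroup.eq_top_iff' K).2 fun b => ?_)
      obtain ⟨c, hc, hb⟩ := hsimple x hxM b
      have hcK : c ∈ K := Subgroup.normalClosure_le_normal (by simpa using hxK) hc
      simpa using K.mul_mem (hle hb) hcK

theorem measurableSet_image_charFun [Countable G] :
    MeasurableSet (charFun '' {M : Subgroup G | IsMaximalNormal M}) := by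
  have h (a : G) : Measurable fun χ : G → Bool => χ a = true :=
    measurableSet_setOfPred.1
      (measurableSet_eq_fun (measurable_pi_apply a) measurable_const)
  have heq : charFun '' {M : Subgroup G | IsMaximalNormal M} = {χ | _} :=
    Set.ext mem_image_charFun_iff
  rw [heq, measurableSet_setOfPred]
  refine (h 1).and (.and ?_ (.and ?_ (.and ?_ (.and ?_ ?_))))
  · exact .forall fun a => .forall fun b => (h a).imp ((h b).imp (h _))
  · exact .forall fun a => (h a).imp (h _)
  · exact .forall fun a => .forall fun g => (h a).imp (h _)
  · exact .exists fun a => (h a).not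
  · exact .forall fun a => (h a).not.imp (.forall fun b => .exists fun c =>
      measurable_const.and (h _))

/-- An uncountable Borel set contains a Cantor set: a perfect family of maximal normal subgroups. -/
theorem exists_continuous_isMaximalNormal [Countable G]
    (h : ¬ {M : Subgroup G | IsMaximalNormal M}.Countable) :
    ∃ M : (ℕ → Bool) → Subgroup G, (∀ a, IsMaximalNormal (M a)) ∧ Function.Injective M ∧
      Continuous fun a => charFun (M a) := by
  have : PolishSpace (G → Bool) := { }
  obtain ⟨t, htle, hpol, hclosed, -⟩ := (measurableSet_image_charFun (G := G)).isClopenable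
  obtain ⟨f, hf, hfc, hfi⟩ := @IsClosed.exists_nat_bool_injection_of_not_countable _ t hpol _
    hclosed fun hc => h (countable_of_injective_of_countable_image charFun_injective.injOn hc)
  choose M hM hMf using fun a => hf (mem_range_self a)
  refine ⟨M, hM, fun a b hab => hfi ?_, ?_⟩
  · rw [← hMf a, ← hMf b, hab]
  · simp only [hMf]
    exact continuous_le_rng htle hfc

/-- There is a family of finitely generated simple groups, indexed by the Cantor space, no two
of which embed into each other. An embedding `Fₖ ⧸ M → Fₖ ⧸ N` lifts to an endomorphism of `Fₖ`,
of which there are countably many, and `M` is the preimage of `N`. -/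
theorem exists_antichain :
    ∃ (k : ℕ) (M : (ℕ → Bool) → KMarkedGroup k), (∀ a, IsMaximalNormal (M a).1) ∧
      ∀ a b, a ≠ b → ∀ w : Fin k → FreeGroup (Fin k),
        (M b).1 ≠ (M a).1.comap (FreeGroup.lift w) := by
  obtain ⟨k, hk⟩ := exists_not_countable_isMaximalNormal
  obtain ⟨M, hM, hinj, hc⟩ := exists_continuous_isMaximalNormal hk
  obtain ⟨g, hg⟩ := exists_independent_family hc (charFun_injective.comp hinj)
    (Φ := fun (w : Fin k → FreeGroup (Fin k)) χ => χ ∘ FreeGroup.lift w)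
    (fun w => by fun_prop)
  refine ⟨k, fun a => ⟨M (g a), (hM _).normal⟩, fun a => hM _, fun a b hab w h => hg a b hab w ?_⟩
  change M (g b) = _ at h
  simp only [h]
  rfl

end Antichain

/-! ### Greatest residually-`C` quotients of simple groups -/

section Residual

variable {k : ℕ}

/-- The group underlying a marked group. -/
def KMarkedGroup.toGrp (N : KMarkedGroup k) : GrpCat.{0} :=
  letI := N.2
  GrpCat.of (FreeGroup (Fin k) ⧸ N.1)

/-- Homomorphisms between marked groups lift to endomorphisms of the free group. -/
theorem KMarkedGroup.exists_eq_comap {M N : KMarkedGroup k} (f : M.toGrp →* N.toGrp)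
    (hf : Function.Injective f) :
    ∃ w : Fin k → FreeGroup (Fin k), M.1 = N.1.comap (FreeGroup.lift w) := by
  have := M.2
  have := N.2
  let f' : FreeGroup (Fin k) ⧸ M.1 →* FreeGroup (Fin k) ⧸ N.1 := f
  choose w hw using fun i => QuotientGroup.mk'_surjective N.1
    (f' (QuotientGroup.mk' M.1 (FreeGroup.of i)))
  have h : f'.comp (QuotientGroup.mk' M.1) = (QuotientGroup.mk' N.1).comp (FreeGroup.lift w) := by
    refine FreeGroup.ext_hom _ _ fun i => ?_
    simpa using (hw i).symm
  have h1 : (f'.comp (QuotientGroup.mk' M.1)).ker = M.1 := by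
    rw [← MonoidHom.comap_ker, (MonoidHom.ker_eq_bot_iff f').2 hf, MonoidHom.comap_bot,
      QuotientGroup.ker_mk']
  refine ⟨w, h1.symm.trans ?_⟩
  rw [h, ← MonoidHom.comap_ker, QuotientGroup.ker_mk']

theorem KMarkedGroup.res_eq_self {C : Set GrpCat.{0}} {N : KMarkedGroup k} (h : N.toGrp ∈ C) :
    N.res C = N := by
  have := N.2
  have h1 : residualKernel C (FreeGroup (Fin k) ⧸ N.1) = ⊥ := by
    refine eq_bot_iff.2 ((iInf₂_le N.toGrp h).trans ?_)
    exact (iInf₂_le (MonoidHom.id _) Function.surjective_id).trans MonoidHom.ker_id.le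
  refine Subtype.ext ?_
  change (residualKernel C (FreeGroup (Fin k) ⧸ N.1)).comap (QuotientGroup.mk' N.1) = N.1
  rw [h1, MonoidHom.comap_bot, QuotientGroup.ker_mk']

theorem KMarkedGroup.res_eq_top {C : Set GrpCat.{0}} {N : KMarkedGroup k}
    (hN : IsMaximalNormal N.1)
    (h : ∀ H ∈ C, ¬ ∃ f : N.toGrp →* H, Function.Injective f) : (N.res C).1 = ⊤ := by
  have := N.2
  have := hN.isSimpleGroup
  have h1 : residualKernel C (FreeGroup (Fin k) ⧸ N.1) = ⊤ := by
    simp only [residualKernel, iInf_eq_top]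
    intro H hH f _
    refine (IsSimpleGroup.eq_bot_or_eq_top_of_normal f.ker inferInstance).resolve_left
      fun hf => h H hH ⟨f, (MonoidHom.ker_eq_bot_iff f).1 hf⟩
  change (residualKernel C (FreeGroup (Fin k) ⧸ N.1)).comap (QuotientGroup.mk' N.1) = ⊤
  rw [h1, Subgroup.comap_top]

theorem isSetOfFGSimple_image {ι : Type*} {M : ι → KMarkedGroup k}
    (hM : ∀ a, IsMaximalNormal (M a).1) (A : Set ι) :
    IsSetOfFGSimple ((fun a => (M a).toGrp) '' A) := by
  rintro _ ⟨a, -, rfl⟩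
  have := (M a).2
  exact ⟨inferInstanceAs (Group.FG (FreeGroup (Fin k) ⧸ (M a).1)), (hM a).isSimpleGroup⟩

/-- For a family of simple groups none of which embeds into another, the greatest residually
`avoidingClass S` quotients of its members determine the subfamily `S`. -/
theorem res_image_eq_top_iff {ι : Type*} {M : ι → KMarkedGroup k}
    (hM : ∀ a, IsMaximalNormal (M a).1)
    (hanti : ∀ a b, a ≠ b → ∀ w : Fin k → FreeGroup (Fin k),
      (M b).1 ≠ (M a).1.comap (FreeGroup.lift w)) (A : Set ι) (a : ι) :
    ((M a).res (avoidingClass ((fun a => (M a).toGrp) '' A))).1 = ⊤ ↔ a ∈ A := by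
  constructor
  · intro h
    by_contra ha
    refine (hM a).ne_top ?_
    rw [KMarkedGroup.res_eq_self] at h
    · exact h
    · rintro _ ⟨b, hb, rfl⟩ ⟨f, hf⟩
      obtain ⟨w, hw⟩ := KMarkedGroup.exists_eq_comap f hf
      exact hanti a b (fun hab => ha (hab ▸ hb)) w hw
  · exact fun ha => KMarkedGroup.res_eq_top (hM a) fun H hH => hH _ ⟨a, ha, rfl⟩

/-- There are as many subsets of the Cantor space as maps `Res`, in a way that lets a subset be
recovered from the marked groups with trivial image. -/
theorem exists_res_family :
    ∃ (R : Set (ℕ → Bool) → MarkedGroup → MarkedGroup) (x : (ℕ → Bool) → MarkedGroup),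
      (∀ A, ∃ S, IsSetOfFGSimple S ∧ R A = Res (avoidingClass S)) ∧
      ∀ A a, (R A (x a)).2.1 = ⊤ ↔ a ∈ A := by
  obtain ⟨k, M, hM, hanti⟩ := exists_antichain
  exact ⟨fun A => Res (avoidingClass ((fun a => (M a).toGrp) '' A)), fun a => ⟨k, M a⟩,
    fun A => ⟨_, isSetOfFGSimple_image hM A, rfl⟩, res_image_eq_top_iff hM hanti⟩

end Residual

/-! ### Lower cones of Weihrauch reducibility -/

section Reductions

open TopologicalSpace Topology in
/-- The information that a partial function on Baire space with domain `D` extracts from basic open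
sets: `(V, n, m)` records that all points of `D` in `V` are sent to sequences with `n`-th
entry `m`. -/
def basicCode (D : Set Baire) (F : Baire → Baire) : Set (countableBasis Baire × ℕ × ℕ) :=
  {c | ∀ q ∈ D, q ∈ c.1.1 → F q c.2.1 = c.2.2}

open TopologicalSpace Topology in
/-- A continuous partial function on Baire space is determined by its code. -/
theorem eq_of_basicCode_eq {D D' : Set Baire} {F F' : Baire → Baire} (hF : ContinuousOn F D)
    (h : basicCode D F = basicCode D' F') {p : Baire} (hp : p ∈ D) (hp' : p ∈ D') :
    F p = F' p := by
  funext n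
  have hopen : IsOpen {y : Baire | y n = F p n} :=
    isOpen_discrete ({F p n} : Set ℕ) |>.preimage (continuous_apply (A := fun _ : ℕ => ℕ) n)
  obtain ⟨u, hu, hpu, hsub⟩ := mem_nhdsWithin.1 (hF p hp (hopen.mem_nhds rfl))
  obtain ⟨V, hV, hpV, hVu⟩ := (isBasis_countableBasis Baire).exists_subset_of_mem_open hpu hu
  have hmem : ((⟨V, hV⟩, n, F p n) : countableBasis Baire × ℕ × ℕ) ∈ basicCode D F :=
    fun q hq hqV => hsub ⟨hVu hqV, hq⟩
  rw [h] at hmem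
  exact (hmem p hp' hpV).symm

/-- A continuous Weihrauch reduction of a single-valued problem to a given one is determined, as far
as the reduced problem is concerned, by the codes of its two realizers: only continuum many
problems reduce to a given one. -/
theorem mk_setOf_weihrauchLE_le (θ : ∀ k : ℕ, ℕ → FreeGroup (Fin k))
    (hθ : ∀ k, Function.Surjective (θ k)) (R : MarkedGroup → MarkedGroup) :
    #{Q : MarkedGroup → MarkedGroup | WeihrauchLE (problemOf θ hθ Q) (problemOf θ hθ R)} ≤ 𝔠 := by
  let E := Set (TopologicalSpace.countableBasis Baire × ℕ × ℕ)
  have hE : #(E × E) ≤ 𝔠 := by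
    have h1 : #E ≤ 𝔠 := by
      rw [Cardinal.mk_set, ← Cardinal.two_power_aleph0]
      exact Cardinal.power_le_power_left two_ne_zero Cardinal.mk_le_aleph0
    rw [Cardinal.mk_prod, Cardinal.lift_id, ← Cardinal.continuum_mul_self]
    exact mul_le_mul' h1 h1
  refine le_trans ?_ hE
  have key : ∀ Q : {Q : MarkedGroup → MarkedGroup |
      WeihrauchLE (problemOf θ hθ Q) (problemOf θ hθ R)}, ∃ (DH DK : Set Baire)
      (H K : Baire → Baire) (V : RepSpace), ContinuousOn H DH ∧ ContinuousOn K DK ∧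
      ∀ (G : MarkedGroup) (p : Baire), (wordProblemSpace θ hθ).IsName p G → p ∈ DK ∧
        ∃ (v : V.carrier) (z : MarkedGroup), (V.prod (wordProblemSpace θ hθ)).IsName (K p) (v, z) ∧
        ∀ q, (V.prod (wordProblemSpace θ hθ)).IsName q (v, R z) → q ∈ DH ∧
          (wordProblemSpace θ hθ).IsName (H q) (Q.1 G) := by
    rintro ⟨Q, V, h, k, ⟨DH, H, hH, hHr⟩, ⟨DK, K, hK, hKr⟩, hdom, hval⟩
    refine ⟨DH, DK, H, K, V, hH, hK, fun G p hp => ?_⟩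
    have hG : G ∈ MultiFun.dom (problemOf θ hθ Q).f := ⟨Q G, rfl⟩
    obtain ⟨y, hsub, b, ⟨hsub', ⟨v, z⟩, hz, hb⟩, hy⟩ := hdom hG
    obtain ⟨hpD, ⟨v, z⟩, hvz, hname⟩ := hKr p G hp ⟨_, hz⟩
    refine ⟨hpD, v, z, hname, fun q hq => ?_⟩
    have hmem : ((v, R z) : V.carrier × MarkedGroup) ∈
        MultiFun.comp (MultiFun.idProd V.carrier (problemOf θ hθ R).f) k G :=
      ⟨hsub', (v, z), hvz, rfl, rfl⟩
    obtain ⟨hqD, y', hy', hn⟩ := hHr q (v, R z) hq (hsub hmem)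
    have hQ : y' = Q G := hval G hG ⟨hsub, (v, R z), hmem, hy'⟩
    subst hQ
    exact ⟨hqD, hn⟩
  choose DH DK H K V hH hK hkey using key
  refine Cardinal.mk_le_of_injective
    (f := fun Q => (basicCode (DH Q) (H Q), basicCode (DK Q) (K Q))) fun Q Q' hQQ => ?_
  obtain ⟨hcH, hcK⟩ := Prod.ext_iff.1 hQQ
  refine Subtype.ext (funext fun G => ?_)
  obtain ⟨p, hp⟩ := (wordProblemSpace θ hθ).surjective G
  obtain ⟨hpD, v, z, hK1, hq⟩ := hkey Q G p hp
  obtain ⟨hpD', v', z', hK1', hq'⟩ := hkey Q' G p hp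
  have hKK : K Q p = K Q' p := eq_of_basicCode_eq (hK Q) hcK hpD hpD'
  have hz : z = z' := (wordProblemSpace θ hθ).functional _ _ _ hK1.2 (hKK ▸ hK1'.2)
  subst hz
  -- `q` is an input for both outer realizers: its even part names `v` and `v'`, which are points of
  -- the auxiliary spaces of the two reductions, and its odd part names `R z`
  obtain ⟨r, hr⟩ := (wordProblemSpace θ hθ).surjective (R z)
  let q : Baire := fun n => if n % 2 = 0 then K Q p n else r (n / 2)
  have heven : (fun n => q (2 * n)) = fun n => K Q p (2 * n) := by
    funext n; simp [q]
  have hodd : (fun n => q (2 * n + 1)) = r := by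
    funext n
    simp only [q]
    rw [if_neg (by omega), show (2 * n + 1) / 2 = n by omega]
  have hnq : (V Q).IsName (fun n => q (2 * n)) v := heven ▸ hK1.1
  have hnq' : (V Q').IsName (fun n => q (2 * n)) v' := by
    rw [heven, hKK]; exact hK1'.1
  have hnr : (wordProblemSpace θ hθ).IsName (fun n => q (2 * n + 1)) (R z) := hodd ▸ hr
  obtain ⟨hqD, hn⟩ := hq q ⟨hnq, hnr⟩
  obtain ⟨hqD', hn'⟩ := hq' q ⟨hnq', hnr⟩
  rw [eq_of_basicCode_eq (hH Q) hcH hqD hqD'] at hn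
  exact (wordProblemSpace θ hθ).functional _ _ _ hn hn'

end Reductions

/-! ### Cardinalities -/

section Counting

open Set

/-- If each member of a family of `2 ^ 𝔠` objects is related to at most continuum many others, a
maximal pairwise unrelated subfamily has `2 ^ 𝔠` members. -/
theorem exists_pairwise_of_mk_le {α : Type} (r : α → α → Prop) {B : Set α} (hB : #B = 2 ^ 𝔠)
    (hr : ∀ x, #{y | r y x} ≤ 𝔠) :
    ∃ F ⊆ B, #F = 2 ^ 𝔠 ∧ F.Pairwise fun x y => ¬ (r x y ∧ r y x) := by
  obtain ⟨F, hF⟩ := zorn_subset {F : Set α | F ⊆ B ∧ F.Pairwise fun x y => ¬ (r x y ∧ r y x)} (by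
    intro c hc hchain
    exact ⟨⋃₀ c, ⟨sUnion_subset fun s hs => (hc hs).1,
      (pairwise_sUnion hchain.directedOn).2 fun s hs => (hc hs).2⟩,
      fun s hs => subset_sUnion_of_mem hs⟩)
  refine ⟨F, hF.prop.1, le_antisymm (hB ▸ Cardinal.mk_le_mk_of_subset hF.prop.1) ?_, hF.prop.2⟩
  have hcover : B ⊆ ⋃ x : F, insert x.1 {y | r y x} := by
    intro y hy
    by_contra hn
    simp only [mem_iUnion, mem_insert_iff, mem_ofPred_eq, not_exists, not_or] at hn
    have hins : insert y F ⊆ F := hF.le_of_ge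
      ⟨insert_subset hy hF.prop.1, hF.prop.2.insert fun x hx _ =>
        ⟨fun h => (hn ⟨x, hx⟩).2 h.1, fun h => (hn ⟨x, hx⟩).2 h.2⟩⟩ (subset_insert y F)
    exact (hn ⟨y, hins (mem_insert y F)⟩).1 rfl
  have hle : (2 ^ 𝔠 : Cardinal.{0}) ≤ #F * 𝔠 := by
    rw [← hB]
    refine (Cardinal.mk_le_mk_of_subset hcover).trans ((Cardinal.mk_iUnion_le _).trans ?_)
    refine mul_le_mul' le_rfl (ciSup_le' fun x => ?_)
    refine Cardinal.mk_insert_le.trans ((add_le_add_left (hr x) 1).trans ?_)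
    exact (Cardinal.add_eq_left Cardinal.aleph0_le_continuum
      (Cardinal.one_le_aleph0.trans Cardinal.aleph0_le_continuum)).le
  by_contra hlt
  have hlt' := Cardinal.mul_lt_of_lt (Cardinal.aleph0_le_continuum.trans (Cardinal.cantor 𝔠).le)
    (not_le.1 hlt) (Cardinal.cantor 𝔠)
  exact absurd hle (not_le.2 hlt')

theorem mk_markedGroup_le : #MarkedGroup ≤ 𝔠 := by
  have hk : ∀ k, #(KMarkedGroup k) ≤ 𝔠 := fun k => by
    refine (Cardinal.mk_subtype_le _).trans ((Cardinal.mk_le_of_injective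
      (f := fun N : Subgroup (FreeGroup (Fin k)) => (N : Set (FreeGroup (Fin k))))
      SetLike.coe_injective).trans ?_)
    rw [Cardinal.mk_set, ← Cardinal.two_power_aleph0]
    exact Cardinal.power_le_power_left two_ne_zero Cardinal.mk_le_aleph0
  rw [Cardinal.mk_sigma]
  refine (Cardinal.sum_le_sum _ (fun _ => 𝔠) hk).trans ?_
  simp

instance secondCountableTopology_kMarkedGroup (k : ℕ) : SecondCountableTopology (KMarkedGroup k) :=
  TopologicalSpace.secondCountableTopology_induced _ _ KMarkedGroup.char

/-- A space with a countable base has at most continuum many Borel sets. -/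
theorem mk_setOf_borel_le (X : Type) [TopologicalSpace X] [SecondCountableTopology X] :
    #{s : Set X | @MeasurableSet X (borel X) s} ≤ 𝔠 := by
  rw [(TopologicalSpace.isBasis_countableBasis X).borel_eq_generateFrom]
  exact MeasurableSpace.cardinal_measurableSet_le_continuum
    ((TopologicalSpace.countable_countableBasis X).le_aleph0.trans Cardinal.aleph0_le_continuum)

/-- The marked groups that are trivial form a closed set. -/
theorem isClosed_setOf_eq_top : IsClosed {G : MarkedGroup | G.2.1 = ⊤} := by
  refine isClosed_sigma_iff.2 fun k => ?_
  have h : Sigma.mk k ⁻¹' {G : MarkedGroup | G.2.1 = ⊤}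
      = ⋂ w : FreeGroup (Fin k), {N : KMarkedGroup k | N.char w = true} := by
    ext N
    simp [KMarkedGroup.char, Subgroup.eq_top_iff']
  rw [h]
  have hc : Continuous (KMarkedGroup.char (k := k)) := continuous_induced_dom
  exact isClosed_iInter fun w =>
    isClosed_eq ((continuous_apply w).comp hc) continuous_const

end Counting

end ResWeihrauch

theorem mainTheorem12 (θ : ∀ k : ℕ, ℕ → FreeGroup (Fin k))
    (hθ : ∀ k, Function.Surjective (θ k)) :
    Cardinal.mk (Set.range ResWeihrauch.Res) = 2 ^ (2 ^ Cardinal.aleph0.{0} : Cardinal.{0}) ∧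
    (∃ 𝓕 : Set (ResWeihrauch.MarkedGroup → ResWeihrauch.MarkedGroup),
      (∀ R ∈ 𝓕, ∃ S : Set GrpCat.{0}, ResWeihrauch.IsSetOfFGSimple S ∧
        R = ResWeihrauch.Res (ResWeihrauch.avoidingClass S)) ∧
      Cardinal.mk 𝓕 = 2 ^ (2 ^ Cardinal.aleph0.{0} : Cardinal.{0}) ∧
      𝓕.Pairwise fun R R' => ¬ ResWeihrauch.WeihrauchEquiv
        (ResWeihrauch.problemOf θ hθ R) (ResWeihrauch.problemOf θ hθ R')) ∧
    ∃ S : Set GrpCat.{0}, ResWeihrauch.IsSetOfFGSimple S ∧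
      ¬ @Measurable ResWeihrauch.MarkedGroup ResWeihrauch.MarkedGroup
        (borel ResWeihrauch.MarkedGroup) (borel ResWeihrauch.MarkedGroup)
        (ResWeihrauch.Res (ResWeihrauch.avoidingClass S)) := by
  obtain ⟨R, x, hR, hx⟩ := ResWeihrauch.exists_res_family
  have hinj : Function.Injective R := fun A A' h => by
    ext a
    rw [← hx, ← hx, h]
  have hset : #(Set (ℕ → Bool)) = 2 ^ 𝔠 := by simp
  have hB : #(Set.range R) = 2 ^ 𝔠 := by rw [Cardinal.mk_range_eq R hinj, hset]
  rw [Cardinal.two_power_aleph0]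
  refine ⟨le_antisymm ?_ ?_, ?_, ?_⟩
  · refine (Cardinal.mk_set_le _).trans ?_
    rw [← Cardinal.power_def]
    refine (Cardinal.power_le_power_right ResWeihrauch.mk_markedGroup_le).trans ?_
    refine (Cardinal.power_le_power_left Cardinal.continuum_ne_zero
      ResWeihrauch.mk_markedGroup_le).trans ?_
    rw [Cardinal.power_self_eq Cardinal.aleph0_le_continuum]
  · rw [← hB]
    refine Cardinal.mk_le_mk_of_subset (Set.range_subset_iff.2 fun A => ?_)
    obtain ⟨S, -, hS⟩ := hR A
    exact ⟨_, hS.symm⟩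
  · obtain ⟨F, hFB, hF, hpair⟩ := ResWeihrauch.exists_pairwise_of_mk_le
      (fun Q Q' => ResWeihrauch.WeihrauchLE (ResWeihrauch.problemOf θ hθ Q)
        (ResWeihrauch.problemOf θ hθ Q')) hB
      (ResWeihrauch.mk_setOf_weihrauchLE_le θ hθ)
    refine ⟨F, fun Q hQ => ?_, hF, hpair⟩
    obtain ⟨A, rfl⟩ := hFB hQ
    exact hR A
  · by_contra! hmeas
    refine absurd (ResWeihrauch.mk_setOf_borel_le ResWeihrauch.MarkedGroup)
      (not_le.2 ((Cardinal.cantor 𝔠).trans_le ?_))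
    rw [← hset]
    -- a subset of the Cantor space is recovered from the set of groups with trivial image
    refine Cardinal.mk_le_of_injective
      (f := fun A => ⟨R A ⁻¹' {G : ResWeihrauch.MarkedGroup | G.2.1 = ⊤}, ?_⟩) fun A A' h => ?_
    · obtain ⟨S, hS, hRS⟩ := hR A
      rw [hRS]
      let : MeasurableSpace ResWeihrauch.MarkedGroup := borel ResWeihrauch.MarkedGroup
      have : BorelSpace ResWeihrauch.MarkedGroup := ⟨rfl⟩
      exact hmeas S hS ResWeihrauch.isClosed_setOf_eq_top.measurableSet
    · ext a
      rw [← hx, ← hx]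
      exact Set.ext_iff.1 (congrArg Subtype.val h) (x a)
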